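/- Let $\mathbb D=\{|z|<1\}$, $\mathbb T=\{|z|=1\}$, and let $m$ be normalized Lebesgue measure on $\mathbb T$. For a continuous function $u:\mathbb D\to\mathbb C$ put $\|u\|_\infty=\sup_{z\in\mathbb D}|u(z)|$ and $\|u\|_1=\sup_{0<\rho<1}\int_{\mathbb T}|u(\rho t)|\,dm(t)$. For $q\in\{1,\infty\}$ let $H^q$ be the set of holomorphic $f:\mathbb D\to\mathbb C$ with $\|f\|_q<\infty$, and let $H^1_0=\{h\in H^1: h(0)=0\}$. For $k\ge 1$ let $\mathcal P_{k-1}$ be the set of complex polynomials of degree at most $k-1$, and let $\mathcal P_{-1}=\{0\}$. For $f\in H^\infty$ and integers $k\ge 0$ write $\widehat f_k=f^{(k)}(0)/k!$, $$E_k(f)_\infty=\inf_{p\in\mathcal P_{k-1}}\|f-p\|_\infty,\qquad \mathcal E_k(f)_1=\inf_{p\in\mathcal P_{k-1},\,h\in H^1_0}\|f-(p+\overline h)\|_1 .$$ (In particular $E_0(f)_\infty=\|f\|_\infty$.) Let $n,N\ge 0$ be integers with $N\ge 2n+1$. Then for every $f\in H^\infty$ $$|\widehat f_n|+\tfrac12\,\mathcal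 E_N(f)_1\le E_n(f)_\infty .$$ The constant $\tfrac12$ cannot be improved: for all such $n,N$ and every real $c>\tfrac12$ there is $f\in H^\infty$ with $|\widehat f_n|+c\,\mathcal E_N(f)_1>E_n(f)_\infty$. -/

import Mathlib

open MeasureTheory
open scoped ENNReal NNReal Real ComplexConjugate

namespace BestApprox

/-- The Hardy norm of a function on the open unit disc, for an exponent `1 ≤ q ≤ ∞`:
`sup_{|z| < 1} |f z|` if `q = ∞`, and the supremum over `0 < ρ < 1` of
`(∫ |f (ρ t)| ^ q dm(t)) ^ (1 / q)` if `q < ∞`, where `m` is the normalized Lebesgue measure on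
the unit circle, parametrized by `t ↦ exp (2 π i t)` on `ℝ / ℤ`. It takes
values in `[0, ∞]` and makes sense for functions that need not be holomorphic; only the values of `f` on the open unit disc matter. -/
noncomputable def hardyNorm (q : ℝ≥0∞) (f : ℂ → ℂ) : ℝ≥0∞ :=
  if q = ∞ then ⨆ z ∈ Metric.ball (0 : ℂ) 1, ‖f z‖ₑ
  else ⨆ ρ ∈ Set.Ioo (0 : ℝ) 1,
    (∫⁻ t : UnitAddCircle, ‖f ((ρ : ℂ) * (AddCircle.toCircle t : ℂ))‖ₑ ^ q.toReal
      ∂AddCircle.haarAddCircle) ^ (1 / q.toReal)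

/-- The Hardy space `H^q`: functions holomorphic in the open unit disc with finite norm. -/
def hardySpace (q : ℝ≥0∞) : Set (ℂ → ℂ) :=
  {f | DifferentiableOn ℂ f (Metric.ball (0 : ℂ) 1) ∧ hardyNorm q f < ∞}

/-- The functions of `H^q` that vanish at the origin. -/
def hardySpaceZero (q : ℝ≥0∞) : Set (ℂ → ℂ) :=
  {h | h ∈ hardySpace q ∧ h 0 = 0}

/-- The `k`-th Taylor coefficient at the origin. -/
noncomputable def taylorCoeff (f : ℂ → ℂ) (k : ℕ) : ℂ :=
  iteratedDeriv k f 0 / (k.factorial : ℂ)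

/-- The best approximation `E_n(f)_q` by polynomials of degree at most `n - 1`
(`Polynomial.degreeLT ℂ n` consists of the polynomials of degree `< n`, so it is `{0}` for
`n = 0`). -/
noncomputable def bestApprox (q : ℝ≥0∞) (n : ℕ) (f : ℂ → ℂ) : ℝ≥0∞ :=
  ⨅ p ∈ Polynomial.degreeLT ℂ n, hardyNorm q (fun z => f z - p.eval z)

/-- The distance in the norm of index `1` from `f` to the sums `p + conj h`, where `p` is a
polynomial of degree at most `k - 1` (`p = 0` for `k = 0`) and `h ∈ H^1` with `h 0 = 0`. -/
noncomputable def coBestApprox (k : ℕ) (f : ℂ → ℂ) : ℝ≥0∞ :=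
  ⨅ p ∈ Polynomial.degreeLT ℂ k, ⨅ h ∈ hardySpaceZero 1,
    hardyNorm 1 (fun z => f z - (p.eval z + conj (h z)))

end BestApprox

/-!
For `g ∈ H^∞` with `|g| ≤ M`, let `u = g - 2 M z ^ n + v`, where `v` is the harmonic extension of
the boundary function `z ^ (2 n) * conj g`. On the circle
`u = -2 z ^ n (M - Re (g / z ^ n))`, so that `∫ |u| dm = 2 (M - Re ĝ_n)`. The analytic part of
`2 M z ^ n - v` is a polynomial of degree at most `2 n < N` and its antianalytic part vanishes at
the origin, hence the co-approximation of `g` is at most `2 (M - Re ĝ_n)`. As boundary values are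
only available on smaller circles, this is carried out for the dilations of `g`. Applied to
`g = c (f - p)`, with the unimodular `c` that makes the `n`-th coefficient nonnegative, it gives the
inequality.

For sharpness, pairing with `z ^ (-N)` on circles annihilates all `p + conj h`, so `|f̂_N|` bounds
the co-approximation of `f` from below. For `f z = z ^ n (r - z ^ m) / (1 - r z ^ m)` with
`N = n + m` one has `|f| ≤ 1`, `f̂_n = r` and `|f̂_N| = 1 - r ^ 2`, and
`r + c (1 - r ^ 2) > 1` as soon as `c (1 + r) > 1`.
-/

namespace BestApprox

open AddCircle Filter Metric Real Topology
open scoped Polynomial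

theorem circleAverage_eq_integral_haarAddCircle {E : Type*} [NormedAddCommGroup E]
    [NormedSpace ℝ E] (F : ℂ → E) (R : ℝ) :
    circleAverage F 0 R = ∫ t : UnitAddCircle, F (R * toCircle t) ∂haarAddCircle := by
  have hscale := intervalIntegral.integral_comp_mul_left (a := 0) (b := 1)
    (fun θ : ℝ => F (circleMap 0 R θ)) (c := 2 * π) (by positivity)
  simp only [mul_zero, mul_one] at hscale
  rw [AddCircle.integral_haarAddCircle, ← UnitAddCircle.intervalIntegral_preimage 0,
    circleAverage, ← hscale]
  simp [AddCircle.toCircle_apply_mk, circleMap]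

theorem enorm_circleAverage_le_lintegral {E : Type*} [NormedAddCommGroup E] [NormedSpace ℝ E]
    (F : ℂ → E) (R : ℝ) :
    ‖circleAverage F 0 R‖ₑ ≤ ∫⁻ t : UnitAddCircle, ‖F (R * toCircle t)‖ₑ ∂haarAddCircle := by
  rw [circleAverage_eq_integral_haarAddCircle]
  exact enorm_integral_le_lintegral_enorm _

theorem continuous_comp_toCircle {X : Type*} [TopologicalSpace X] {F : ℂ → X}
    (hF : ContinuousOn F (sphere 0 1)) : Continuous fun t : UnitAddCircle => F (toCircle t) :=
  hF.comp_continuous (by fun_prop) fun t => by simp [Circle.norm_coe]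

theorem lintegral_enorm_toCircle {E : Type*} [NormedAddCommGroup E] {u : ℂ → E}
    (hu : ContinuousOn u (sphere 0 1)) :
    ∫⁻ t : UnitAddCircle, ‖u (toCircle t)‖ₑ ∂haarAddCircle =
      ENNReal.ofReal (circleAverage (fun z => ‖u z‖) 0 1) := by
  have hint : Integrable (fun t : UnitAddCircle => u (toCircle t)) haarAddCircle :=
    (continuous_comp_toCircle hu).integrable_of_hasCompactSupport (.of_compactSpace _)
  rw [circleAverage_eq_integral_haarAddCircle, ← ofReal_integral_norm_eq_lintegral_enorm hint]
  simp

theorem continuousOn_div_pow_sphere {g : ℂ → ℂ} {R : ℝ} (hR : 0 < R)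
    (hg : ContinuousOn g (sphere 0 R)) (n : ℕ) :
    ContinuousOn (fun z => g z / z ^ n) (sphere 0 R) :=
  hg.div (by fun_prop) fun z hz => pow_ne_zero n (ne_zero_of_mem_sphere hR.ne' ⟨z, hz⟩)

theorem circleAverage_div_pow {g : ℂ → ℂ} {R : ℝ} (hR : 0 < R)
    (hg : DiffContOnCl ℂ g (ball 0 R)) (n : ℕ) :
    circleAverage (fun z => g z / z ^ n) 0 R = taylorCoeff g n := by
  have hcauchy := hg.circleIntegral_one_div_sub_center_pow_smul hR n
  have hintegrand : (fun z : ℂ => (1 / (z - 0) ^ (n + 1)) • g z) =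
      fun z => (z - 0)⁻¹ • (g z / z ^ n) := by
    ext z
    simp only [sub_zero, smul_eq_mul, pow_succ, div_eq_mul_inv, mul_inv]
    ring
  rw [hintegrand] at hcauchy
  rw [circleAverage_eq_circleIntegral hR.ne', hcauchy, taylorCoeff]
  have := Complex.two_pi_I_ne_zero
  simp only [smul_eq_mul]
  field_simp

theorem taylorCoeff_zero (g : ℂ → ℂ) : taylorCoeff g 0 = g 0 := by
  simp [taylorCoeff]

theorem circleAverage_eq_apply_zero {g : ℂ → ℂ} {R : ℝ} (hR : 0 < R)
    (hg : DiffContOnCl ℂ g (ball 0 R)) : circleAverage g 0 R = g 0 := by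
  simpa [taylorCoeff_zero] using circleAverage_div_pow hR hg 0

theorem diffContOnCl_ball_of_lt {g : ℂ → ℂ} {R ρ : ℝ}
    (hg : DifferentiableOn ℂ g (ball 0 R)) (hρ : ρ < R) : DiffContOnCl ℂ g (ball 0 ρ) :=
  (hg.mono ((closure_ball_subset_closedBall).trans (closedBall_subset_ball hρ))).diffContOnCl

theorem taylorCoeff_const_mul (c : ℂ) (g : ℂ → ℂ) (n : ℕ) :
    taylorCoeff (fun z => c * g z) n = c * taylorCoeff g n := by
  simp [taylorCoeff, iteratedDeriv_const_mul_field, mul_div_assoc]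

theorem diffContOnCl_comp_const_mul {g : ℂ → ℂ} {r : ℝ} (hr : 0 < r)
    (hg : DiffContOnCl ℂ g (ball 0 r)) : DiffContOnCl ℂ (fun z => g (r * z)) (ball 0 1) :=
  hg.comp (Differentiable.diffContOnCl (by fun_prop)) fun z hz => by
    rw [mem_ball_zero_iff] at hz ⊢
    simpa [abs_of_pos hr] using mul_lt_mul_of_pos_left hz hr

theorem taylorCoeff_comp_const_mul {g : ℂ → ℂ} {r : ℝ} (hr : 0 < r)
    (hg : DiffContOnCl ℂ g (ball 0 r)) (n : ℕ) :
    taylorCoeff (fun z => g (r * z)) n = r ^ n * taylorCoeff g n := by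
  have hr' : (r : ℂ) ≠ 0 := by exact_mod_cast hr.ne'
  rw [← circleAverage_div_pow hr hg,
    ← circleAverage_div_pow one_pos (diffContOnCl_comp_const_mul hr hg),
    circleAverage_eq_circleAverage_zero_one (R := r), ← smul_eq_mul, ← circleAverage_fun_smul]
  congr 1
  ext z
  simp only [add_zero, smul_eq_mul, mul_pow]
  field_simp

theorem taylorCoeff_polynomial_eval {p : ℂ[X]} {n : ℕ} (hp : p ∈ Polynomial.degreeLT ℂ n) :
    taylorCoeff (fun z => p.eval z) n = 0 := by
  have hderiv : ∀ k, iteratedDeriv k (fun z => p.eval z) =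
      fun z => (Polynomial.derivative^[k] p).eval z := by
    intro k
    induction k with
    | zero => simp
    | succ k ih =>
      ext z
      rw [iteratedDeriv_succ, ih, Function.iterate_succ_apply', Polynomial.deriv]
  have hzero : Polynomial.derivative^[n] p = 0 := by
    rcases eq_or_ne p 0 with rfl | hp0
    · simp
    · exact Polynomial.iterate_derivative_eq_zero
        ((Polynomial.natDegree_lt_iff_degree_lt hp0).2 (Polynomial.mem_degreeLT.1 hp))
  simp [taylorCoeff, hderiv, hzero]

theorem taylorCoeff_sub_polynomial_eval {f : ℂ → ℂ} (hf : AnalyticAt ℂ f 0) {n : ℕ} {p : ℂ[X]}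
    (hp : p ∈ Polynomial.degreeLT ℂ n) :
    taylorCoeff (fun z => f z - p.eval z) n = taylorCoeff f n := by
  have hpa : ContDiffAt ℂ n (fun z => p.eval z) 0 := by
    simpa using (p.contDiff_aeval (𝕜 := ℂ) n).contDiffAt
  have hp0 := taylorCoeff_polynomial_eval hp
  unfold taylorCoeff at hp0 ⊢
  rw [iteratedDeriv_fun_sub hf.contDiffAt hpa, sub_div, hp0, sub_zero]

theorem taylorCoeff_pow_mul {h : ℂ → ℂ} (hh : AnalyticAt ℂ h 0) (n : ℕ) :
    taylorCoeff (fun z => z ^ n * h z) n = h 0 := by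
  obtain ⟨R, hR, hdiff⟩ := Metric.eventually_nhds_iff_ball.1 hh.eventually_analyticAt
  have hhR : DifferentiableOn ℂ h (ball 0 R) := fun z hz =>
    (hdiff z hz).differentiableAt.differentiableWithinAt
  have hR2 : 0 < R / 2 := half_pos hR
  have hpow : DifferentiableOn ℂ (fun z => z ^ n * h z) (ball 0 R) := by fun_prop
  rw [← circleAverage_div_pow hR2 (diffContOnCl_ball_of_lt hpow (half_lt_self hR)),
    ← circleAverage_eq_apply_zero hR2 (diffContOnCl_ball_of_lt hhR (half_lt_self hR))]
  refine circleAverage_congr_sphere fun z hz => ?_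
  have hz0 : z ≠ 0 := ne_zero_of_mem_sphere (by positivity) ⟨z, hz⟩
  exact mul_div_cancel_left₀ _ (pow_ne_zero n hz0)

theorem poissonKernel_real_mul_comm (ρ : ℝ) (a b : Circle) :
    poissonKernel 0 (ρ * a) b = poissonKernel 0 (ρ * b) a := by
  have hdist : ‖(b : ℂ) - ρ * a‖ = ‖(a : ℂ) - ρ * b‖ := by
    rw [← sq_eq_sq₀ (norm_nonneg _) (norm_nonneg _), ← Complex.normSq_eq_norm_sq,
      ← Complex.normSq_eq_norm_sq, Complex.normSq_sub, Complex.normSq_sub]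
    simp only [Circle.normSq_coe, Complex.mul_re, Complex.mul_im, map_mul,
      Complex.conj_re, Complex.conj_im, Complex.conj_ofReal, Complex.ofReal_re, Complex.ofReal_im]
    ring
  simp [poissonKernel, hdist, Circle.norm_coe]

theorem poissonKernel_nonneg {w z : ℂ} (hwz : ‖w‖ ≤ ‖z‖) : 0 ≤ poissonKernel 0 w z := by
  simp only [poissonKernel, sub_zero]
  have : ‖w‖ ^ 2 ≤ ‖z‖ ^ 2 := by gcongr
  exact div_nonneg (sub_nonneg.2 this) (by positivity)

theorem continuousOn_poissonKernel :
    ContinuousOn (fun p : ℂ × ℂ => poissonKernel 0 p.1 p.2) (ball 0 1 ×ˢ sphere 0 1) := by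
  simp only [poissonKernel, sub_zero]
  refine ContinuousOn.div (by fun_prop) (by fun_prop) fun p hp => ?_
  have hne : p.2 - p.1 ≠ 0 := sub_ne_zero.2 fun h => by
    have hlt := mem_ball_zero_iff.1 hp.1
    rw [← h, mem_sphere_zero_iff_norm.1 hp.2] at hlt
    exact lt_irrefl _ hlt
  positivity

theorem continuousOn_poissonKernel_sphere {w : ℂ} (hw : w ∈ ball (0 : ℂ) 1) :
    ContinuousOn (poissonKernel 0 w) (sphere 0 1) :=
  continuousOn_poissonKernel.comp (f := fun z => (w, z)) (by fun_prop) fun _ hz => ⟨hw, hz⟩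

theorem lintegral_enorm_poissonKernel {w : ℂ} (hw : w ∈ ball (0 : ℂ) 1) :
    ∫⁻ t : UnitAddCircle, ‖poissonKernel 0 w (toCircle t)‖ₑ ∂haarAddCircle = 1 := by
  have hnonneg : ∀ z ∈ sphere (0 : ℂ) 1, 0 ≤ poissonKernel 0 w z := fun z hz =>
    poissonKernel_nonneg <| by
      simpa [mem_sphere_zero_iff_norm.1 hz] using (mem_ball_zero_iff.1 hw).le
  have hone : circleAverage (poissonKernel 0 w) 0 1 = 1 := by
    have := InnerProductSpace.HarmonicContOnCl.circleAverage_poissonKernel_smul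
      (f := fun _ => (1 : ℝ)) (InnerProductSpace.harmonicContOnCl_const (s := ball 0 1)) hw
    rwa [show poissonKernel 0 w • (fun _ => (1 : ℝ)) = poissonKernel 0 w by ext; simp] at this
  have hnorm : Set.EqOn (fun z => ‖poissonKernel 0 w z‖) (poissonKernel 0 w) (sphere 0 |1|) := by
    rw [abs_one]
    exact fun z hz => Real.norm_of_nonneg (hnonneg z hz)
  rw [lintegral_enorm_toCircle (continuousOn_poissonKernel_sphere hw),
    circleAverage_congr_sphere hnorm, hone, ENNReal.ofReal_one]

theorem mul_toCircle_mem_ball {ρ : ℝ} (hρ : ρ ∈ Set.Ioo (0 : ℝ) 1) (t : UnitAddCircle) :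
    (ρ : ℂ) * toCircle t ∈ ball (0 : ℂ) 1 := by
  simpa [Circle.norm_coe, abs_of_pos hρ.1] using hρ.2

theorem hardyNorm_one (f : ℂ → ℂ) : hardyNorm 1 f = ⨆ ρ ∈ Set.Ioo (0 : ℝ) 1,
    ∫⁻ t : UnitAddCircle, ‖f (ρ * toCircle t)‖ₑ ∂haarAddCircle := by
  simp [hardyNorm]

/-- Averaging the Poisson formula for `u (ρ t)` over `t` integrates the kernel in its first
variable, which by the symmetry `poissonKernel_real_mul_comm` again gives total mass `1`. -/
theorem hardyNorm_one_le_of_poisson {u : ℂ → ℂ} (hu : ContinuousOn u (sphere 0 1))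
    (hpoisson : ∀ w ∈ ball (0 : ℂ) 1, circleAverage (poissonKernel 0 w • u) 0 1 = u w) :
    hardyNorm 1 u ≤ ENNReal.ofReal (circleAverage (fun z => ‖u z‖) 0 1) := by
  rw [hardyNorm_one, ← lintegral_enorm_toCircle hu]
  refine iSup₂_le fun ρ hρ => ?_
  set K : UnitAddCircle → UnitAddCircle → ℝ := fun t s =>
    poissonKernel 0 (ρ * toCircle t) (toCircle s) with hK
  have hKcont : Continuous fun p : UnitAddCircle × UnitAddCircle => K p.1 p.2 :=
    continuousOn_poissonKernel.comp_continuous (f := fun p : UnitAddCircle × UnitAddCircle =>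
      ((ρ * toCircle p.1 : ℂ), (toCircle p.2 : ℂ))) (by fun_prop)
      fun p => ⟨mul_toCircle_mem_ball hρ p.1, by simp [Circle.norm_coe]⟩
  have hucont : Continuous fun t : UnitAddCircle => u (toCircle t) := continuous_comp_toCircle hu
  calc ∫⁻ t : UnitAddCircle, ‖u (ρ * toCircle t)‖ₑ ∂haarAddCircle
      ≤ ∫⁻ t, ∫⁻ s, ‖K t s‖ₑ * ‖u (toCircle s)‖ₑ ∂haarAddCircle ∂haarAddCircle := by
        refine lintegral_mono fun t => ?_
        rw [← hpoisson _ (mul_toCircle_mem_ball hρ t)]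
        simpa only [hK, Pi.smul_apply', enorm_smul, Complex.ofReal_one, one_mul] using
          enorm_circleAverage_le_lintegral (poissonKernel 0 (ρ * toCircle t) • u) 1
    _ = ∫⁻ s, ∫⁻ t, ‖K t s‖ₑ * ‖u (toCircle s)‖ₑ ∂haarAddCircle ∂haarAddCircle := by
        refine lintegral_lintegral_swap (Continuous.aemeasurable ?_)
        have hcont : Continuous fun p : UnitAddCircle × UnitAddCircle =>
            ‖K p.1 p.2 • u (toCircle p.2)‖ₑ := (hKcont.smul (hucont.comp continuous_snd)).enorm
        simpa only [enorm_smul, Function.uncurry_def] using hcont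
    _ = ∫⁻ s : UnitAddCircle, ‖u (toCircle s)‖ₑ ∂haarAddCircle := by
        refine lintegral_congr fun s => ?_
        simp only [hK, poissonKernel_real_mul_comm ρ _ (toCircle s)]
        rw [lintegral_mul_const' _ _ enorm_ne_top,
          lintegral_enorm_poissonKernel (mul_toCircle_mem_ball hρ s), one_mul]

theorem circleAverage_poissonKernel_smul_add_conj {A B : ℂ → ℂ}
    (hA : DiffContOnCl ℂ A (ball 0 1)) (hB : DiffContOnCl ℂ B (ball 0 1))
    {w : ℂ} (hw : w ∈ ball (0 : ℂ) 1) :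
    circleAverage (poissonKernel 0 w • fun z => A z + conj (B z)) 0 1 = A w + conj (B w) := by
  have hint {C : ℂ → ℂ} (hC : ContinuousOn C (sphere 0 1)) :
      CircleIntegrable (poissonKernel 0 w • C) 0 1 :=
    ((continuousOn_poissonKernel_sphere hw).smul hC).circleIntegrable zero_le_one
  have hAs := hA.continuousOn_ball.mono sphere_subset_closedBall
  have hBs := hB.continuousOn_ball.mono sphere_subset_closedBall
  have hsplit : (poissonKernel 0 w • fun z => A z + conj (B z)) =
      poissonKernel 0 w • A + poissonKernel 0 w • fun z => conj (B z) := by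
    rw [← smul_add]; rfl
  have hconj : (poissonKernel 0 w • fun z => conj (B z)) =
      (Complex.conjCLE : ℂ →L[ℝ] ℂ) ∘ (poissonKernel 0 w • B) := by
    ext z; simp
  have hBconj : ContinuousOn (fun z => conj (B z)) (sphere 0 1) :=
    Complex.continuous_conj.comp_continuousOn hBs
  rw [hsplit, circleAverage_add (hint hAs) (hint hBconj), hconj,
    (Complex.conjCLE : ℂ →L[ℝ] ℂ).circleAverage_comp_comm (hint hBs),
    hA.circleAverage_poissonKernel_smul hw, hB.circleAverage_poissonKernel_smul hw]
  simp

theorem lintegral_le_hardyNorm_one (f : ℂ → ℂ) {ρ : ℝ} (hρ : ρ ∈ Set.Ioo (0 : ℝ) 1) :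
    ∫⁻ t : UnitAddCircle, ‖f (ρ * toCircle t)‖ₑ ∂haarAddCircle ≤ hardyNorm 1 f := by
  rw [hardyNorm_one]
  exact le_iSup₂ (f := fun (ρ : ℝ) (_ : ρ ∈ Set.Ioo (0 : ℝ) 1) =>
    ∫⁻ t : UnitAddCircle, ‖f (ρ * toCircle t)‖ₑ ∂haarAddCircle) ρ hρ

theorem hardyNorm_one_le_liminf {ι : Type*} {l : Filter ι} [l.IsCountablyGenerated] [l.NeBot]
    {F : ι → ℂ → ℂ} {f : ℂ → ℂ} (hF : ∀ i, ContinuousOn (F i) (ball 0 1))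
    (hlim : ∀ z ∈ ball (0 : ℂ) 1, Tendsto (fun i => F i z) l (𝓝 (f z))) :
    hardyNorm 1 f ≤ liminf (fun i => hardyNorm 1 (F i)) l := by
  rw [hardyNorm_one]
  refine iSup₂_le fun ρ hρ => ?_
  have hcont (i : ι) : Continuous fun t : UnitAddCircle => F i (ρ * toCircle t) :=
    (hF i).comp_continuous (by fun_prop) (mul_toCircle_mem_ball hρ)
  calc ∫⁻ t : UnitAddCircle, ‖f (ρ * toCircle t)‖ₑ ∂haarAddCircle
      = ∫⁻ t : UnitAddCircle, liminf (fun i => ‖F i (ρ * toCircle t)‖ₑ) l ∂haarAddCircle :=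
        lintegral_congr fun t => ((hlim _ (mul_toCircle_mem_ball hρ t)).enorm.liminf_eq).symm
    _ ≤ liminf (fun i => ∫⁻ t : UnitAddCircle, ‖F i (ρ * toCircle t)‖ₑ ∂haarAddCircle) l :=
        lintegral_liminf_le fun i => (hcont i).enorm.measurable
    _ ≤ liminf (fun i => hardyNorm 1 (F i)) l :=
        liminf_le_liminf <| .of_forall fun i => lintegral_le_hardyNorm_one (F i) hρ
theorem hardyNorm_top (f : ℂ → ℂ) : hardyNorm ∞ f = ⨆ z ∈ ball (0 : ℂ) 1, ‖f z‖ₑ := by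
  simp [hardyNorm]

theorem enorm_le_hardyNorm_top (f : ℂ → ℂ) {z : ℂ} (hz : z ∈ ball (0 : ℂ) 1) :
    ‖f z‖ₑ ≤ hardyNorm ∞ f := by
  rw [hardyNorm_top]
  exact le_iSup₂ (f := fun (z : ℂ) (_ : z ∈ ball (0 : ℂ) 1) => ‖f z‖ₑ) z hz

theorem hardyNorm_top_le_ofReal {f : ℂ → ℂ} {C : ℝ} (hf : ∀ z ∈ ball (0 : ℂ) 1, ‖f z‖ ≤ C) :
    hardyNorm ∞ f ≤ ENNReal.ofReal C := by
  rw [hardyNorm_top]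
  exact iSup₂_le fun z hz => by
    rw [← ofReal_norm]
    exact ENNReal.ofReal_le_ofReal (hf z hz)

theorem norm_le_toReal_hardyNorm_top {f : ℂ → ℂ} (hf : hardyNorm ∞ f < ∞) {z : ℂ}
    (hz : z ∈ ball (0 : ℂ) 1) : ‖f z‖ ≤ (hardyNorm ∞ f).toReal := by
  rw [← toReal_enorm]
  exact ENNReal.toReal_mono hf.ne (enorm_le_hardyNorm_top f hz)

theorem hardyNorm_one_le_hardyNorm_top (f : ℂ → ℂ) : hardyNorm 1 f ≤ hardyNorm ∞ f := by
  rw [hardyNorm_one]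
  refine iSup₂_le fun ρ hρ => ?_
  calc ∫⁻ t : UnitAddCircle, ‖f (ρ * toCircle t)‖ₑ ∂haarAddCircle
      ≤ ∫⁻ _ : UnitAddCircle, hardyNorm ∞ f ∂haarAddCircle :=
        lintegral_mono fun t => enorm_le_hardyNorm_top f (mul_toCircle_mem_ball hρ t)
    _ = hardyNorm ∞ f := by simp

theorem hardySpace_top_subset_one : hardySpace ∞ ⊆ hardySpace 1 := fun _ hf =>
  ⟨hf.1, (hardyNorm_one_le_hardyNorm_top _).trans_lt hf.2⟩

theorem hardyNorm_const_mul {c : ℂ} (hc : ‖c‖ = 1) (q : ℝ≥0∞) (f : ℂ → ℂ) :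
    hardyNorm q (fun z => c * f z) = hardyNorm q f := by
  have hce : ‖c‖ₑ = 1 := by rw [← ofReal_norm, hc, ENNReal.ofReal_one]
  simp only [hardyNorm, enorm_mul, hce, one_mul]

theorem const_mul_mem_hardySpace {c : ℂ} (hc : ‖c‖ = 1) {q : ℝ≥0∞} {f : ℂ → ℂ}
    (hf : f ∈ hardySpace q) : (fun z => c * f z) ∈ hardySpace q :=
  ⟨hf.1.const_mul c, (hardyNorm_const_mul hc q f).trans_lt hf.2⟩

theorem coBestApprox_le_hardyNorm (N : ℕ) (f : ℂ → ℂ) : coBestApprox N f ≤ hardyNorm 1 f := by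
  have hzero : (fun _ => 0 : ℂ → ℂ) ∈ hardySpaceZero 1 :=
    ⟨⟨differentiableOn_const 0, by simp [hardyNorm_one]⟩, rfl⟩
  refine (iInf₂_le (0 : ℂ[X]) (Submodule.zero_mem _)).trans ((iInf₂_le _ hzero).trans_eq ?_)
  simp

theorem bestApprox_le_hardyNorm (q : ℝ≥0∞) (n : ℕ) (f : ℂ → ℂ) :
    bestApprox q n f ≤ hardyNorm q f := by
  refine (iInf₂_le (0 : ℂ[X]) (Submodule.zero_mem _)).trans_eq ?_
  simp

theorem const_mul_mem_hardySpaceZero {c : ℂ} (hc : ‖c‖ = 1) {q : ℝ≥0∞} {h : ℂ → ℂ}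
    (hh : h ∈ hardySpaceZero q) : (fun z => c * h z) ∈ hardySpaceZero q :=
  ⟨const_mul_mem_hardySpace hc hh.1, by simp [hh.2]⟩

theorem coBestApprox_polynomial_add_const_mul_le {c : ℂ} (hc : ‖c‖ = 1) {N : ℕ} {q : ℂ[X]}
    (hq : q ∈ Polynomial.degreeLT ℂ N) (g : ℂ → ℂ) :
    coBestApprox N (fun z => q.eval z + c * g z) ≤ coBestApprox N g := by
  refine le_iInf₂ fun p hp => le_iInf₂ fun h hh => ?_
  have hp' : q + c • p ∈ Polynomial.degreeLT ℂ N := add_mem hq (Submodule.smul_mem _ c hp)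
  have hh' := const_mul_mem_hardySpaceZero (c := conj c) (by simpa using hc) hh
  refine (iInf₂_le _ hp').trans ((iInf₂_le _ hh').trans_eq ?_)
  rw [← hardyNorm_const_mul hc 1 fun z => g z - (p.eval z + conj (h z))]
  congr 1
  ext z
  simp only [Polynomial.eval_add, Polynomial.eval_smul, smul_eq_mul, map_mul, Complex.conj_conj]
  ring

theorem circleAverage_conj_div_pow {h : ℂ → ℂ} {R : ℝ} (hR : 0 < R)
    (hh : DiffContOnCl ℂ h (ball 0 R)) (h0 : h 0 = 0) (N : ℕ) :
    circleAverage (fun z => conj (h z) / z ^ N) 0 R = 0 := by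
  have hprod : DiffContOnCl ℂ (fun z => ((R : ℂ) ^ (2 * N))⁻¹ * (z ^ N * h z)) (ball 0 R) :=
    (differentiable_pow N).diffContOnCl.smul hh |>.const_smul ((R : ℂ) ^ (2 * N))⁻¹
  have hcongr : Set.EqOn (fun z => conj (h z) / z ^ N)
      ((Complex.conjCLE : ℂ →L[ℝ] ℂ) ∘ fun z => ((R : ℂ) ^ (2 * N))⁻¹ * (z ^ N * h z))
      (sphere 0 |R|) := fun z hz => by
    rw [abs_of_pos hR, mem_sphere_zero_iff_norm] at hz
    have hz0 : z ≠ 0 := norm_pos_iff.1 (hz ▸ hR)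
    have hconj : conj z * z = (R : ℂ) ^ 2 := by rw [Complex.conj_mul', hz]
    simp only [Function.comp_apply, ContinuousLinearEquiv.coe_coe, Complex.conjCLE_apply, map_mul,
      map_inv₀, map_pow, Complex.conj_ofReal, pow_mul]
    rw [← hconj]
    have := (map_ne_zero (starRingEnd ℂ)).2 hz0
    field_simp
    ring
  rw [circleAverage_congr_sphere hcongr, (Complex.conjCLE : ℂ →L[ℝ] ℂ).circleAverage_comp_comm
      ((hprod.continuousOn_ball.mono sphere_subset_closedBall).circleIntegrable hR.le),
    circleAverage_eq_apply_zero hR hprod]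
  simp [h0]

theorem enorm_pow_mul_taylorCoeff_le {g h : ℂ → ℂ} {R : ℝ} (hR : 0 < R)
    (hg : DiffContOnCl ℂ g (ball 0 R)) (hh : DiffContOnCl ℂ h (ball 0 R)) (h0 : h 0 = 0) (N : ℕ) :
    ‖(R : ℂ) ^ N * taylorCoeff g N‖ₑ ≤
      ∫⁻ t : UnitAddCircle, ‖g (R * toCircle t) - conj (h (R * toCircle t))‖ₑ ∂haarAddCircle := by
  have hint {C : ℂ → ℂ} (hC : ContinuousOn C (sphere 0 R)) :
      CircleIntegrable (fun z => C z / z ^ N) 0 R :=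
    (continuousOn_div_pow_sphere hR hC N).circleIntegrable hR.le
  have hgs := hg.continuousOn_ball.mono sphere_subset_closedBall
  have hhs := hh.continuousOn_ball.mono sphere_subset_closedBall
  have haverage : circleAverage (fun z => (R : ℂ) ^ N * ((g z - conj (h z)) / z ^ N)) 0 R =
      (R : ℂ) ^ N * taylorCoeff g N := by
    simp only [← smul_eq_mul (a := (R : ℂ) ^ N), sub_div]
    rw [circleAverage_fun_smul, circleAverage_fun_sub (hint hgs)
        (hint (C := fun z => conj (h z)) (Complex.continuous_conj.comp_continuousOn hhs)),
      circleAverage_div_pow hR hg, circleAverage_conj_div_pow hR hh h0, sub_zero]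
  rw [← haverage]
  refine (enorm_circleAverage_le_lintegral _ R).trans_eq (lintegral_congr fun t => ?_)
  have hR' : (R : ℂ) ≠ 0 := by exact_mod_cast hR.ne'
  simp only [← ofReal_norm, norm_mul, norm_div, norm_pow, Circle.norm_coe, mul_one]
  congr 1
  exact mul_div_cancel₀ _ (pow_ne_zero N (norm_ne_zero_iff.2 hR'))

theorem enorm_taylorCoeff_le_hardyNorm_one {g h : ℂ → ℂ}
    (hg : DifferentiableOn ℂ g (ball 0 1)) (hh : DifferentiableOn ℂ h (ball 0 1)) (h0 : h 0 = 0)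
    (N : ℕ) : ‖taylorCoeff g N‖ₑ ≤ hardyNorm 1 (fun z => g z - conj (h z)) := by
  have hlim : Tendsto (fun ρ : ℝ => ‖(ρ : ℂ) ^ N * taylorCoeff g N‖ₑ) (𝓝[<] 1)
      (𝓝 ‖taylorCoeff g N‖ₑ) := by
    have hcont : Continuous fun ρ : ℝ => ‖(ρ : ℂ) ^ N * taylorCoeff g N‖ₑ := by fun_prop
    simpa using (hcont.tendsto 1).mono_left nhdsWithin_le_nhds
  refine le_of_tendsto hlim ?_
  filter_upwards [Ioo_mem_nhdsLT zero_lt_one] with ρ hρ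
  exact (enorm_pow_mul_taylorCoeff_le hρ.1 (diffContOnCl_ball_of_lt hg hρ.2)
    (diffContOnCl_ball_of_lt hh hρ.2) h0 N).trans (lintegral_le_hardyNorm_one _ hρ)

theorem enorm_taylorCoeff_le_coBestApprox {f : ℂ → ℂ} (hf : DifferentiableOn ℂ f (ball 0 1))
    (N : ℕ) : ‖taylorCoeff f N‖ₑ ≤ coBestApprox N f := by
  refine le_iInf₂ fun p hp => le_iInf₂ fun h hh => ?_
  have hfa : AnalyticAt ℂ f 0 := hf.analyticAt (ball_mem_nhds 0 one_pos)
  have hfp : DifferentiableOn ℂ (fun z => f z - p.eval z) (ball 0 1) := by fun_prop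
  rw [← taylorCoeff_sub_polynomial_eval hfa hp]
  simpa only [sub_sub] using enorm_taylorCoeff_le_hardyNorm_one hfp hh.1.1 hh.2 N

theorem enorm_taylorCoeff_le_hardyNorm_top {f : ℂ → ℂ} (hf : DifferentiableOn ℂ f (ball 0 1))
    (n : ℕ) : ‖taylorCoeff f n‖ₑ ≤ hardyNorm ∞ f :=
  ((enorm_taylorCoeff_le_coBestApprox hf n).trans (coBestApprox_le_hardyNorm n f)).trans
    (hardyNorm_one_le_hardyNorm_top f)

theorem dslope_mem_hardySpace_top {h : ℂ → ℂ} (hh : h ∈ hardySpace ∞) :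
    dslope h 0 ∈ hardySpace ∞ := by
  refine ⟨(Complex.differentiableOn_dslope (ball_mem_nhds 0 one_pos)).2 hh.1, ?_⟩
  set C := (hardyNorm ∞ h).toReal
  have hC : ∀ z ∈ ball (0 : ℂ) 1, ‖h z‖ ≤ C := fun z => norm_le_toReal_hardyNorm_top hh.2
  have hmaps : Set.MapsTo h (ball 0 1) (closedBall (h 0) (2 * C)) := fun z hz => by
    rw [mem_closedBall_iff_norm]
    linarith [norm_sub_le (h z) (h 0), hC z hz, hC 0 (by simp)]
  exact (hardyNorm_top_le_ofReal fun z hz =>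
    Complex.norm_dslope_le_div_of_mapsTo_ball hh.1 hmaps hz).trans_lt ENNReal.ofReal_lt_top

theorem exists_polynomial_add_pow_mul {g : ℂ → ℂ} (hg : g ∈ hardySpace ∞) (d : ℕ) :
    ∃ P : ℂ[X], P.natDegree ≤ d ∧ ∃ h ∈ hardySpace ∞, ∀ z, g z = P.eval z + z ^ (d + 1) * h z := by
  have hdslope (h : ℂ → ℂ) (z : ℂ) : h z = h 0 + z * dslope h 0 z := by
    linear_combination -(sub_smul_dslope h 0 z)
  induction d with
  | zero =>
    refine ⟨Polynomial.C (g 0), by simp, dslope g 0, dslope_mem_hardySpace_top hg, fun z => ?_⟩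
    simpa using hdslope g z
  | succ d ih =>
    obtain ⟨P, hP, h, hh, hgP⟩ := ih
    refine ⟨P + Polynomial.monomial (d + 1) (h 0), ?_, dslope h 0, dslope_mem_hardySpace_top hh,
      fun z => ?_⟩
    · exact Polynomial.natDegree_add_le_of_degree_le (hP.trans d.le_succ)
        (Polynomial.natDegree_monomial_le _)
    · rw [hgP, hdslope h z, Polynomial.eval_add, Polynomial.eval_monomial]
      ring

/-- The polynomial `∑ k ≤ d, conj (a k) * z ^ (d - k)` for `P = ∑ k ≤ d, a k * z ^ k`, which on the
unit circle takes the values of `z ^ d * conj P`. -/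
noncomputable def conjReflect (d : ℕ) (P : ℂ[X]) : ℂ[X] := (P.map (starRingEnd ℂ)).reflect d

theorem natDegree_conjReflect_le (d : ℕ) (P : ℂ[X]) :
    (conjReflect d P).natDegree ≤ max d P.natDegree :=
  Polynomial.natDegree_reflect_le.trans (max_le_max_left d Polynomial.natDegree_map_le)

theorem eval_conjReflect_of_norm_eq_one {d : ℕ} {P : ℂ[X]} (hP : P.natDegree ≤ d) {z : ℂ}
    (hz : ‖z‖ = 1) : (conjReflect d P).eval z = z ^ d * conj (P.eval z) := by
  have hzz : z * conj z = 1 := by rw [Complex.mul_conj', hz]; simp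
  let _ : Invertible (conj z) := ⟨z, hzz, by rw [mul_comm, hzz]⟩
  have hreflect := Polynomial.eval₂_reflect_mul_pow (RingHom.id ℂ) (conj z) d
    (P.map (starRingEnd ℂ)) (Polynomial.natDegree_map_le.trans hP)
  rw [Polynomial.eval₂_id, Polynomial.eval₂_id, Polynomial.eval_map_apply] at hreflect
  rw [← hreflect, conjReflect, mul_left_comm, ← mul_pow, hzz, one_pow, mul_one]
  rfl

/-- For `g z = P.eval z + z ^ (d + 1) * h z` with `P` of degree at most `d`, this is the harmonic
extension to the disc of the boundary function `z ^ d * conj (g z)`. With `d = 2 * n` it supplies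
the near-best `p + conj h` in `coBestApprox` for `g`. -/
noncomputable def reflection (d : ℕ) (P : ℂ[X]) (h : ℂ → ℂ) (z : ℂ) : ℂ :=
  (conjReflect d P).eval z + conj (z * h z)

theorem reflection_of_norm_eq_one {d : ℕ} {P : ℂ[X]} (hP : P.natDegree ≤ d) (h : ℂ → ℂ) {z : ℂ}
    (hz : ‖z‖ = 1) :
    reflection d P h z = z ^ d * conj (P.eval z + z ^ (d + 1) * h z) := by
  have hzz : z ^ d * conj z ^ d = 1 := by rw [← mul_pow, Complex.mul_conj', hz]; simp
  rw [reflection, eval_conjReflect_of_norm_eq_one hP hz]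
  simp only [map_add, map_mul, map_pow]
  linear_combination -(conj z * conj (h z)) * hzz

theorem continuousOn_reflection {s : Set ℂ} {h : ℂ → ℂ} (hh : ContinuousOn h s) (d : ℕ)
    (P : ℂ[X]) : ContinuousOn (reflection d P h) s :=
  (conjReflect d P).continuousOn.add
    (Complex.continuous_conj.comp_continuousOn (continuousOn_id.mul hh))

theorem natDegree_comp_C_mul_X_le {R : Type*} [CommSemiring R] (P : R[X]) (r : R) :
    (P.comp (Polynomial.C r * Polynomial.X)).natDegree ≤ P.natDegree :=
  Polynomial.natDegree_comp_le.trans <| mul_le_of_le_one_right' <|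
    (Polynomial.natDegree_C_mul_le _ _).trans Polynomial.natDegree_X_le

theorem tendsto_comp_ofReal_mul {X : Type*} [TopologicalSpace X] {g : ℂ → X} {z : ℂ}
    (hg : ContinuousAt g z) : Tendsto (fun r : ℝ => g (r * z)) (𝓝 1) (𝓝 (g z)) := by
  refine hg.tendsto.comp ?_
  have hcont : Continuous fun r : ℝ => r * z := by fun_prop
  simpa using hcont.tendsto 1

theorem tendsto_reflection_dilation {h : ℂ → ℂ} {z : ℂ} (hh : ContinuousAt h z) (d : ℕ)
    (P : ℂ[X]) :
    Tendsto (fun r : ℝ => reflection d (P.comp (Polynomial.C (r : ℂ) * Polynomial.X))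
      (fun w => r ^ (d + 1) * h (r * w)) z) (𝓝 1) (𝓝 (reflection d P h z)) := by
  have heval (Q : ℂ[X]) (hQ : Q.natDegree ≤ P.natDegree) : (conjReflect d Q).eval z =
      ∑ i ∈ Finset.range (max d P.natDegree + 1),
        conj (Q.coeff (Polynomial.revAt d i)) * z ^ i := by
    have hdeg := (natDegree_conjReflect_le d Q).trans (max_le_max_left d hQ)
    rw [Polynomial.eval_eq_sum_range' (Nat.lt_succ_of_le hdeg)]
    simp only [conjReflect, Polynomial.coeff_reflect, Polynomial.coeff_map]
  have hofReal : Tendsto (fun r : ℝ => (r : ℂ)) (𝓝 1) (𝓝 1) := by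
    simpa using Complex.continuous_ofReal.tendsto 1
  simp only [reflection, heval _ (natDegree_comp_C_mul_X_le P _), heval P le_rfl,
    Polynomial.comp_C_mul_X_coeff]
  refine .add (tendsto_finsetSum _ fun i _ => .mul_const _ ?_) ?_
  · refine (Complex.continuous_conj.tendsto _).comp ?_
    simpa using (hofReal.pow (Polynomial.revAt d i)).const_mul (P.coeff (Polynomial.revAt d i))
  · refine (Complex.continuous_conj.tendsto _).comp ?_
    simpa using ((hofReal.pow (d + 1)).mul (tendsto_comp_ofReal_mul hh)).const_mul z

theorem norm_sub_add_sq_mul_conj {a w : ℂ} {M : ℝ} (hw : ‖w‖ = 1) (ha : ‖a‖ ≤ M) :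
    ‖a - 2 * M * w + w ^ 2 * conj a‖ = 2 * (M - (a / w).re) := by
  have hww : w * conj w = 1 := by rw [Complex.mul_conj', hw]; simp
  have hw0 : w ≠ 0 := norm_ne_zero_iff.1 (by simp [hw])
  obtain ⟨b, rfl⟩ : ∃ b, a = b * w := ⟨a / w, (div_mul_cancel₀ a hw0).symm⟩
  have hb : ‖b‖ ≤ M := by simpa [hw] using ha
  have hfactor : b * w - 2 * M * w + w ^ 2 * conj (b * w) =
      -(w * ((2 * (M - b.re) : ℝ) : ℂ)) := by
    have hre := Complex.add_conj b
    push_cast at hre ⊢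
    rw [map_mul]
    linear_combination w * hre + w * conj b * hww
  rw [hfactor, norm_neg, norm_mul, hw, one_mul,
    Complex.norm_of_nonneg (by linarith [b.re_le_norm]), mul_div_cancel_right₀ _ hw0]

theorem norm_add_reflection_of_norm_eq_one {n : ℕ} {P : ℂ[X]} (hP : P.natDegree ≤ 2 * n)
    {h : ℂ → ℂ} {a z : ℂ} {M : ℝ} (ha : a = P.eval z + z ^ (2 * n + 1) * h z) (haM : ‖a‖ ≤ M)
    (hz : ‖z‖ = 1) :
    ‖a - 2 * M * z ^ n + reflection (2 * n) P h z‖ = 2 * (M - (a / z ^ n).re) := by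
  rw [reflection_of_norm_eq_one hP h hz, ← ha, mul_comm 2 n, pow_mul]
  exact norm_sub_add_sq_mul_conj (by simp [hz]) haM

theorem circleAverage_re_div_pow {g : ℂ → ℂ} {R : ℝ} (hR : 0 < R)
    (hg : DiffContOnCl ℂ g (ball 0 R)) (n : ℕ) :
    circleAverage (fun z => (g z / z ^ n).re) 0 R = (taylorCoeff g n).re := by
  have hcont := continuousOn_div_pow_sphere hR
    (hg.continuousOn_ball.mono sphere_subset_closedBall) n
  rw [← circleAverage_div_pow hR hg]
  exact Complex.reCLM.circleAverage_comp_comm (hcont.circleIntegrable hR.le)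

theorem circleAverage_norm_add_reflection {n : ℕ} {P : ℂ[X]} {g h : ℂ → ℂ} {M : ℝ}
    (hP : P.natDegree ≤ 2 * n) (hgdiff : DiffContOnCl ℂ g (ball 0 1))
    (hg : ∀ z, g z = P.eval z + z ^ (2 * n + 1) * h z) (hM : ∀ z ∈ sphere (0 : ℂ) 1, ‖g z‖ ≤ M) :
    circleAverage (fun z => ‖g z - 2 * M * z ^ n + reflection (2 * n) P h z‖) 0 1 =
      2 * (M - (taylorCoeff g n).re) := by
  have hre : ContinuousOn (fun z => (g z / z ^ n).re) (sphere 0 1) :=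
    Complex.continuous_re.comp_continuousOn <| continuousOn_div_pow_sphere one_pos
      (hgdiff.continuousOn_ball.mono sphere_subset_closedBall) n
  calc circleAverage (fun z => ‖g z - 2 * M * z ^ n + reflection (2 * n) P h z‖) 0 1
      = circleAverage (fun z => (2 : ℝ) • (M - (g z / z ^ n).re)) 0 1 :=
        circleAverage_congr_sphere fun z hz => by
          rw [abs_one] at hz
          exact norm_add_reflection_of_norm_eq_one hP (hg z) (hM z hz)
            (mem_sphere_zero_iff_norm.1 hz)
    _ = 2 * (M - (taylorCoeff g n).re) := by
        rw [circleAverage_fun_smul, circleAverage_fun_sub (circleIntegrable_const M 0 1)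
          (hre.circleIntegrable zero_le_one), circleAverage_const,
          circleAverage_re_div_pow one_pos hgdiff, smul_eq_mul]

theorem hardyNorm_one_add_reflection_le_of_diffContOnCl {n : ℕ} {P : ℂ[X]} {g h : ℂ → ℂ} {M : ℝ}
    (hP : P.natDegree ≤ 2 * n) (hh : DiffContOnCl ℂ h (ball 0 1))
    (hg : ∀ z, g z = P.eval z + z ^ (2 * n + 1) * h z) (hM : ∀ z ∈ sphere (0 : ℂ) 1, ‖g z‖ ≤ M) :
    hardyNorm 1 (fun z => g z - 2 * M * z ^ n + reflection (2 * n) P h z) ≤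
      ENNReal.ofReal (2 * (M - (taylorCoeff g n).re)) := by
  have hgdiff : DiffContOnCl ℂ g (ball 0 1) := by
    rw [funext hg]
    exact P.differentiable.diffContOnCl.add ((differentiable_pow _).diffContOnCl.smul hh)
  have hA : DiffContOnCl ℂ (fun z => g z - 2 * M * z ^ n + (conjReflect (2 * n) P).eval z)
      (ball 0 1) :=
    (hgdiff.sub ((differentiable_pow n).diffContOnCl.const_smul (2 * M : ℂ))).add
      (conjReflect (2 * n) P).differentiable.diffContOnCl
  have hB : DiffContOnCl ℂ (fun z => z * h z) (ball 0 1) := differentiable_id.diffContOnCl.smul hh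
  have hgs : ContinuousOn g (sphere 0 1) := hgdiff.continuousOn_ball.mono sphere_subset_closedBall
  have hhs : ContinuousOn h (sphere 0 1) := hh.continuousOn_ball.mono sphere_subset_closedBall
  rw [← circleAverage_norm_add_reflection hP hgdiff hg hM]
  refine hardyNorm_one_le_of_poisson
    ((hgs.sub (by fun_prop)).add (continuousOn_reflection hhs _ P)) fun w hw => ?_
  simpa only [reflection, add_assoc] using circleAverage_poissonKernel_smul_add_conj hA hB hw

theorem hardyNorm_one_add_reflection_dilation_le {n : ℕ} {P : ℂ[X]} {g h : ℂ → ℂ} {M r : ℝ}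
    (hP : P.natDegree ≤ 2 * n) (hh : DifferentiableOn ℂ h (ball 0 1))
    (hg : ∀ z, g z = P.eval z + z ^ (2 * n + 1) * h z) (hM : ∀ z ∈ ball (0 : ℂ) 1, ‖g z‖ ≤ M)
    (hr : r ∈ Set.Ioo (0 : ℝ) 1) :
    hardyNorm 1 (fun z => g (r * z) - 2 * M * z ^ n +
        reflection (2 * n) (P.comp (Polynomial.C (r : ℂ) * Polynomial.X))
          (fun w => r ^ (2 * n + 1) * h (r * w)) z) ≤
      ENNReal.ofReal (2 * (M - r ^ n * (taylorCoeff g n).re)) := by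
  have hgdiff : DifferentiableOn ℂ g (ball 0 1) := by
    rw [funext hg]
    fun_prop
  have htaylor := taylorCoeff_comp_const_mul hr.1 (diffContOnCl_ball_of_lt hgdiff hr.2) n
  rw [show r ^ n * (taylorCoeff g n).re = (taylorCoeff (fun z => g (r * z)) n).re by
    rw [htaylor, ← Complex.ofReal_pow, Complex.re_ofReal_mul]]
  refine hardyNorm_one_add_reflection_le_of_diffContOnCl ?_ ?_ (fun z => ?_) fun z hz => hM _ ?_
  · exact (natDegree_comp_C_mul_X_le P r).trans hP
  · exact (diffContOnCl_comp_const_mul hr.1 (diffContOnCl_ball_of_lt hh hr.2)).const_smul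
      ((r : ℂ) ^ (2 * n + 1))
  · simp only [hg, Polynomial.eval_comp, Polynomial.eval_C_mul, Polynomial.eval_X]
    ring
  · simpa [mem_sphere_zero_iff_norm.1 hz, abs_of_pos hr.1] using hr.2

theorem hardyNorm_one_add_reflection_le {n : ℕ} {P : ℂ[X]} {g h : ℂ → ℂ} {M : ℝ}
    (hP : P.natDegree ≤ 2 * n) (hh : DifferentiableOn ℂ h (ball 0 1))
    (hg : ∀ z, g z = P.eval z + z ^ (2 * n + 1) * h z) (hM : ∀ z ∈ ball (0 : ℂ) 1, ‖g z‖ ≤ M) :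
    hardyNorm 1 (fun z => g z - 2 * M * z ^ n + reflection (2 * n) P h z) ≤
      ENNReal.ofReal (2 * (M - (taylorCoeff g n).re)) := by
  obtain ⟨r, -, hr, hr1⟩ := exists_seq_strictMono_tendsto' (zero_lt_one (α := ℝ))
  have hgdiff : DifferentiableOn ℂ g (ball 0 1) := by
    rw [funext hg]
    fun_prop
  have hcontinuousAt {F : ℂ → ℂ} (hF : DifferentiableOn ℂ F (ball 0 1)) {z : ℂ}
      (hz : z ∈ ball (0 : ℂ) 1) : ContinuousAt F z :=
    hF.continuousOn.continuousAt (isOpen_ball.mem_nhds hz)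
  have hdilate {F : ℂ → ℂ} (hF : DifferentiableOn ℂ F (ball 0 1)) (j : ℕ) :
      ContinuousOn (fun z => F (r j * z)) (ball 0 1) :=
    (diffContOnCl_comp_const_mul (hr j).1 (diffContOnCl_ball_of_lt hF (hr j).2)).continuousOn.mono
      subset_closure
  have hbound : Tendsto (fun j => ENNReal.ofReal (2 * (M - r j ^ n * (taylorCoeff g n).re))) atTop
      (𝓝 (ENNReal.ofReal (2 * (M - (taylorCoeff g n).re)))) := by
    refine ENNReal.tendsto_ofReal ?_
    simpa using (((hr1.pow n).mul_const (taylorCoeff g n).re).const_sub M).const_mul 2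
  rw [← hbound.liminf_eq]
  refine (hardyNorm_one_le_liminf (l := atTop) (F := fun j z => g (r j * z) - 2 * M * z ^ n +
      reflection (2 * n) (P.comp (Polynomial.C (r j : ℂ) * Polynomial.X))
        (fun w => r j ^ (2 * n + 1) * h (r j * w)) z) (fun j => ?_) fun z hz => ?_).trans
    (liminf_le_liminf (.of_forall fun j =>
      hardyNorm_one_add_reflection_dilation_le hP hh hg hM (hr j)))
  · exact ((hdilate hgdiff j).sub (by fun_prop)).add
      (continuousOn_reflection (continuousOn_const.mul (hdilate hh j)) _ _)
  · exact (((tendsto_comp_ofReal_mul (hcontinuousAt hgdiff hz)).sub_const _).add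
      (tendsto_reflection_dilation (hcontinuousAt hh hz) (2 * n) P)).comp hr1


theorem mem_degreeLT_of_natDegree_lt {R : Type*} [Semiring R] {p : R[X]} {n : ℕ}
    (hp : p.natDegree < n) : p ∈ Polynomial.degreeLT R n :=
  Polynomial.mem_degreeLT.2 (Polynomial.degree_le_natDegree.trans_lt (by exact_mod_cast hp))

theorem id_mul_mem_hardySpace_top {h : ℂ → ℂ} (hh : h ∈ hardySpace ∞) :
    (fun z => z * h z) ∈ hardySpace ∞ := by
  refine ⟨differentiableOn_id.mul hh.1, lt_of_le_of_lt (hardyNorm_top_le_ofReal fun z hz => ?_)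
    (ENNReal.ofReal_lt_top (r := (hardyNorm ∞ h).toReal))⟩
  rw [norm_mul]
  exact (mul_le_of_le_one_left (norm_nonneg _) (mem_ball_zero_iff.1 hz).le).trans
    (norm_le_toReal_hardyNorm_top hh.2 hz)

theorem coBestApprox_le_sub_re_taylorCoeff {n N : ℕ} (hN : 2 * n + 1 ≤ N) {g : ℂ → ℂ}
    (hg : g ∈ hardySpace ∞) :
    coBestApprox N g ≤
      ENNReal.ofReal (2 * ((hardyNorm ∞ g).toReal - (taylorCoeff g n).re)) := by
  obtain ⟨P, hP, h, hh, hgP⟩ := exists_polynomial_add_pow_mul hg (2 * n)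
  have hreflection := hardyNorm_one_add_reflection_le hP hh.1 hgP
    fun z => norm_le_toReal_hardyNorm_top hg.2
  set M := (hardyNorm ∞ g).toReal
  have hp : Polynomial.monomial n (2 * M : ℂ) - conjReflect (2 * n) P ∈ Polynomial.degreeLT ℂ N :=
    Submodule.sub_mem _ (Polynomial.monomial_coe_mem_degreeLT ⟨n, by omega⟩ _) <|
      mem_degreeLT_of_natDegree_lt <|
        ((natDegree_conjReflect_le (2 * n) P).trans (max_le le_rfl hP)).trans_lt hN
  have hH : (fun z => -1 * (z * h z)) ∈ hardySpaceZero 1 :=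
    ⟨const_mul_mem_hardySpace (by simp)
      (hardySpace_top_subset_one (id_mul_mem_hardySpace_top hh)), by simp⟩
  refine (iInf₂_le _ hp).trans ((iInf₂_le _ hH).trans (hreflection.trans_eq' ?_))
  congr 1
  ext z
  simp only [Polynomial.eval_sub, Polynomial.eval_monomial, reflection, map_mul, map_neg, map_one]
  ring

theorem enorm_taylorCoeff_add_le_hardyNorm_top {n N : ℕ} (hN : 2 * n + 1 ≤ N) {g : ℂ → ℂ}
    (hg : g ∈ hardySpace ∞) {a : ℝ} (ha : 0 ≤ a) (hga : taylorCoeff g n = a) :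
    ENNReal.ofReal a + 1 / 2 * coBestApprox N g ≤ hardyNorm ∞ g := by
  have haM : a ≤ (hardyNorm ∞ g).toReal := by
    have hcoeff := enorm_taylorCoeff_le_hardyNorm_top hg.1 n
    rwa [hga, ← ofReal_norm, Complex.norm_of_nonneg ha, ENNReal.ofReal_le_iff_le_toReal hg.2.ne]
      at hcoeff
  have hco := coBestApprox_le_sub_re_taylorCoeff hN hg
  rw [hga, Complex.ofReal_re] at hco
  calc ENNReal.ofReal a + 1 / 2 * coBestApprox N g
      ≤ ENNReal.ofReal a +
        ENNReal.ofReal (1 / 2) * ENNReal.ofReal (2 * ((hardyNorm ∞ g).toReal - a)) := by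
        gcongr
        simp
    _ = ENNReal.ofReal (hardyNorm ∞ g).toReal := by
        rw [← ENNReal.ofReal_mul (by norm_num), ← ENNReal.ofReal_add ha (by linarith)]
        ring_nf
    _ = hardyNorm ∞ g := ENNReal.ofReal_toReal hg.2.ne

theorem enorm_taylorCoeff_add_le_bestApprox {n N : ℕ} (hN : 2 * n + 1 ≤ N) {f : ℂ → ℂ}
    (hf : DifferentiableOn ℂ f (ball 0 1)) :
    ‖taylorCoeff f n‖ₑ + 1 / 2 * coBestApprox N f ≤ bestApprox ∞ n f := by
  refine le_iInf₂ fun p hp => ?_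
  obtain hfin | htop := lt_or_ge (hardyNorm ∞ fun z => f z - p.eval z) ∞
  swap
  · exact le_top.trans htop
  have hfa : AnalyticAt ℂ f 0 := hf.analyticAt (ball_mem_nhds 0 one_pos)
  have hfp : (fun z => f z - p.eval z) ∈ hardySpace ∞ := ⟨by fun_prop, hfin⟩
  obtain ⟨c, hc, hphase⟩ := Complex.exists_norm_eq_mul_self (taylorCoeff f n)
  set g : ℂ → ℂ := fun z => c * (f z - p.eval z) with hg
  have hga : taylorCoeff g n = (‖taylorCoeff f n‖ : ℝ) := by
    rw [hg, taylorCoeff_const_mul, taylorCoeff_sub_polynomial_eval hfa hp, hphase]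
  have hpN : p ∈ Polynomial.degreeLT ℂ N := Polynomial.degreeLT_mono (by omega) hp
  have hfg : f = fun z => p.eval z + conj c * g z := by
    have hcc : conj c * c = 1 := by simp [Complex.conj_mul', hc]
    ext z
    linear_combination -(f z - p.eval z) * hcc
  calc ‖taylorCoeff f n‖ₑ + 1 / 2 * coBestApprox N f
      ≤ ENNReal.ofReal ‖taylorCoeff f n‖ + 1 / 2 * coBestApprox N g := by
        rw [ofReal_norm]
        gcongr
        conv_lhs => rw [hfg]
        exact coBestApprox_polynomial_add_const_mul_le (by simpa using hc) hpN g
    _ ≤ hardyNorm ∞ g := enorm_taylorCoeff_add_le_hardyNorm_top hN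
        (const_mul_mem_hardySpace hc hfp) (norm_nonneg _) hga
    _ = hardyNorm ∞ fun z => f z - p.eval z := hardyNorm_const_mul hc ∞ _

theorem norm_sub_le_norm_one_sub_conj_mul {a w : ℂ} (ha : ‖a‖ ≤ 1) (hw : ‖w‖ ≤ 1) :
    ‖a - w‖ ≤ ‖1 - conj a * w‖ := by
  have hidentity : ‖1 - conj a * w‖ ^ 2 - ‖a - w‖ ^ 2 = (1 - ‖a‖ ^ 2) * (1 - ‖w‖ ^ 2) := by
    simp only [Complex.sq_norm, Complex.normSq_apply, Complex.sub_re, Complex.sub_im,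
      Complex.mul_re, Complex.mul_im, Complex.conj_re, Complex.conj_im, Complex.one_re,
      Complex.one_im]
    ring
  rw [← sq_le_sq₀ (norm_nonneg _) (norm_nonneg _)]
  have ha' : 0 ≤ 1 - ‖a‖ ^ 2 := sub_nonneg.2 (pow_le_one₀ (norm_nonneg a) ha)
  have hw' : 0 ≤ 1 - ‖w‖ ^ 2 := sub_nonneg.2 (pow_le_one₀ (norm_nonneg w) hw)
  linarith [mul_nonneg ha' hw']

/-- The function `z ^ n * (r - z ^ m) / (1 - r * z ^ m)`, for `0 < r < 1` a finite Blaschke product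
up to sign. As `r` tends to `1` it shows that the constant `1 / 2` is sharp. -/
noncomputable def extremal (n m : ℕ) (r : ℝ) (z : ℂ) : ℂ :=
  z ^ n * ((r - z ^ m) / (1 - r * z ^ m))

section Extremal

variable {r : ℝ}

theorem one_sub_mul_pow_ne_zero (hr : r ∈ Set.Ioo (0 : ℝ) 1) (m : ℕ) {z : ℂ}
    (hz : z ∈ ball (0 : ℂ) 1) : 1 - r * z ^ m ≠ 0 := by
  have hlt : ‖(r : ℂ) * z ^ m‖ < 1 := by
    rw [norm_mul, Complex.norm_of_nonneg hr.1.le, norm_pow]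
    exact mul_lt_one_of_nonneg_of_lt_one_left hr.1.le hr.2
      (pow_le_one₀ (norm_nonneg z) (mem_ball_zero_iff.1 hz).le)
  intro h
  rw [← sub_eq_zero.1 h, norm_one] at hlt
  exact lt_irrefl _ hlt

theorem norm_extremal_le_one (hr : r ∈ Set.Ioo (0 : ℝ) 1) (n m : ℕ) {z : ℂ}
    (hz : z ∈ ball (0 : ℂ) 1) : ‖extremal n m r z‖ ≤ 1 := by
  have hpow (k : ℕ) : ‖z ^ k‖ ≤ 1 := by
    rw [norm_pow]
    exact pow_le_one₀ (norm_nonneg z) (mem_ball_zero_iff.1 hz).le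
  have hr1 : ‖(r : ℂ)‖ ≤ 1 := by simpa [abs_of_pos hr.1] using hr.2.le
  have hquot := norm_sub_le_norm_one_sub_conj_mul hr1 (hpow m)
  rw [Complex.conj_ofReal] at hquot
  rw [extremal, norm_mul, norm_div]
  exact mul_le_one₀ (hpow n) (by positivity) (div_le_one_of_le₀ hquot (norm_nonneg _))

theorem hardyNorm_top_extremal_le_one (hr : r ∈ Set.Ioo (0 : ℝ) 1) (n m : ℕ) :
    hardyNorm ∞ (extremal n m r) ≤ 1 := by
  simpa using hardyNorm_top_le_ofReal fun z => norm_extremal_le_one hr n m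

theorem differentiableOn_div_one_sub_mul_pow (hr : r ∈ Set.Ioo (0 : ℝ) 1) (m : ℕ) {u : ℂ → ℂ}
    (hu : DifferentiableOn ℂ u (ball 0 1)) :
    DifferentiableOn ℂ (fun z => u z / (1 - r * z ^ m)) (ball 0 1) :=
  hu.div (by fun_prop) fun _ => one_sub_mul_pow_ne_zero hr m

theorem differentiableOn_extremal (hr : r ∈ Set.Ioo (0 : ℝ) 1) (n m : ℕ) :
    DifferentiableOn ℂ (extremal n m r) (ball 0 1) :=
  .fun_mul (by fun_prop) (differentiableOn_div_one_sub_mul_pow hr m (by fun_prop))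

theorem extremal_mem_hardySpace_top (hr : r ∈ Set.Ioo (0 : ℝ) 1) (n m : ℕ) :
    extremal n m r ∈ hardySpace ∞ :=
  ⟨differentiableOn_extremal hr n m,
    (hardyNorm_top_extremal_le_one hr n m).trans_lt ENNReal.one_lt_top⟩

theorem taylorCoeff_extremal (hr : r ∈ Set.Ioo (0 : ℝ) 1) (n : ℕ) {m : ℕ} (hm : 0 < m) :
    taylorCoeff (extremal n m r) n = r := by
  have hquot : DifferentiableOn ℂ (fun z : ℂ => (r - z ^ m) / (1 - r * z ^ m)) (ball 0 1) :=
    differentiableOn_div_one_sub_mul_pow hr m (by fun_prop)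
  refine (taylorCoeff_pow_mul (hquot.analyticAt (ball_mem_nhds 0 one_pos)) n).trans ?_
  simp [hm.ne']

theorem extremal_sub_monomial {z : ℂ} {m : ℕ} (hz : 1 - r * z ^ m ≠ 0) (n : ℕ) :
    extremal n m r z - (Polynomial.monomial n (r : ℂ)).eval z =
      z ^ (n + m) * (-(1 - r ^ 2) / (1 - r * z ^ m)) := by
  rw [extremal, Polynomial.eval_monomial]
  field_simp
  ring

theorem taylorCoeff_extremal_add (hr : r ∈ Set.Ioo (0 : ℝ) 1) (n : ℕ) {m : ℕ} (hm : 0 < m) :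
    taylorCoeff (extremal n m r) (n + m) = -(1 - r ^ 2) := by
  have hball : ball (0 : ℂ) 1 ∈ 𝓝 0 := ball_mem_nhds 0 one_pos
  have hp : Polynomial.monomial n (r : ℂ) ∈ Polynomial.degreeLT ℂ (n + m) :=
    Polynomial.monomial_coe_mem_degreeLT ⟨n, by omega⟩ _
  have hquot : DifferentiableOn ℂ (fun z => -(1 - (r : ℂ) ^ 2) / (1 - r * z ^ m)) (ball 0 1) :=
    differentiableOn_div_one_sub_mul_pow hr m (by fun_prop)
  have heq : (fun z => extremal n m r z - (Polynomial.monomial n (r : ℂ)).eval z) =ᶠ[𝓝 0]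
      fun z => z ^ (n + m) * (-(1 - (r : ℂ) ^ 2) / (1 - r * z ^ m)) :=
    mem_of_superset hball fun z hz => extremal_sub_monomial (one_sub_mul_pow_ne_zero hr m hz) n
  rw [← taylorCoeff_sub_polynomial_eval ((differentiableOn_extremal hr n m).analyticAt hball) hp,
    taylorCoeff, heq.iteratedDeriv_eq, ← taylorCoeff,
    taylorCoeff_pow_mul (hquot.analyticAt hball)]
  simp [hm.ne']

end Extremal

theorem exists_mem_Ioo_one_lt_add_mul {c : ℝ} (hc : 1 / 2 < c) :
    ∃ r ∈ Set.Ioo (0 : ℝ) 1, 1 < r + c * (1 - r ^ 2) := by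
  have hmax : max 0 (1 / c - 1) < 1 := max_lt zero_lt_one <| by
    rw [sub_lt_iff_lt_add, div_lt_iff₀ (by linarith)]
    linarith
  obtain ⟨r, hr, hr1⟩ := exists_between hmax
  obtain ⟨hr0, hrc⟩ := max_lt_iff.1 hr
  rw [sub_lt_iff_lt_add, div_lt_iff₀ (by linarith)] at hrc
  refine ⟨r, ⟨hr0, hr1⟩, ?_⟩
  linarith [mul_pos (sub_pos.2 hr1) (sub_pos.2 hrc)]

theorem exists_bestApprox_lt_enorm_taylorCoeff_add (n : ℕ) {m : ℕ} (hm : 0 < m) {c : ℝ≥0}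
    (hc : 1 / 2 < c) :
    ∃ f ∈ hardySpace ∞,
      bestApprox ∞ n f < ‖taylorCoeff f n‖ₑ + (c : ℝ≥0∞) * coBestApprox (n + m) f := by
  obtain ⟨r, hr, hrc⟩ := exists_mem_Ioo_one_lt_add_mul (c := c) (by exact_mod_cast hc)
  have hr2 : 0 ≤ 1 - r ^ 2 := sub_nonneg.2 (pow_le_one₀ hr.1.le hr.2.le)
  have hn : ‖taylorCoeff (extremal n m r) n‖ₑ = ENNReal.ofReal r := by
    rw [taylorCoeff_extremal hr n hm, ← ofReal_norm, Complex.norm_of_nonneg hr.1.le]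
  have hnm : ‖taylorCoeff (extremal n m r) (n + m)‖ₑ = ENNReal.ofReal (1 - r ^ 2) := by
    rw [taylorCoeff_extremal_add hr n hm, enorm_neg, ← ofReal_norm,
      ← Complex.norm_of_nonneg hr2]
    push_cast
    rfl
  refine ⟨extremal n m r, extremal_mem_hardySpace_top hr n m, ?_⟩
  calc bestApprox ∞ n (extremal n m r)
      ≤ 1 := (bestApprox_le_hardyNorm ∞ n _).trans (hardyNorm_top_extremal_le_one hr n m)
    _ < ENNReal.ofReal (r + c * (1 - r ^ 2)) := ENNReal.one_lt_ofReal.2 hrc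
    _ = ‖taylorCoeff (extremal n m r) n‖ₑ + c * ‖taylorCoeff (extremal n m r) (n + m)‖ₑ := by
        rw [hn, hnm, ENNReal.ofReal_add hr.1.le (by positivity), ENNReal.ofReal_mul c.coe_nonneg,
          ENNReal.ofReal_coe_nnreal]
    _ ≤ ‖taylorCoeff (extremal n m r) n‖ₑ + c * coBestApprox (n + m) (extremal n m r) := by
        gcongr
        exact enorm_taylorCoeff_le_coBestApprox (differentiableOn_extremal hr n m) (n + m)

end BestApprox

theorem mainTheorem4 (n N : ℕ) (hN : 2 * n + 1 ≤ N) :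
    (∀ f ∈ BestApprox.hardySpace ∞,
      ‖BestApprox.taylorCoeff f n‖ₑ + (1 / 2) * BestApprox.coBestApprox N f
        ≤ BestApprox.bestApprox ∞ n f) ∧
    (∀ c : ℝ≥0, 1 / 2 < c →
      ∃ f ∈ BestApprox.hardySpace ∞,
        BestApprox.bestApprox ∞ n f
          < ‖BestApprox.taylorCoeff f n‖ₑ + (c : ℝ≥0∞) * BestApprox.coBestApprox N f) := by
  refine ⟨fun f hf => BestApprox.enorm_taylorCoeff_add_le_bestApprox hN hf.1, fun c hc => ?_⟩
  obtain ⟨m, rfl⟩ := Nat.exists_eq_add_of_le (show n ≤ N by omega)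
  exact BestApprox.exists_bestApprox_lt_enorm_taylorCoeff_add n (by omega) hc
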